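/- **Conventions.** A complex $m\times m$ matrix $\mathbf q=\|q_{ij}\|$ is *multiplicatively anti-symmetric* if all $q_{ij}\neq 0$, $q_{ji}=q_{ij}^{-1}$ and $q_{ii}=1$. For such an $(n+1)\times(n+1)$ matrix (indices $0,\dots,n$), the *quantum space* $\mathcal A^n_{\mathbf q}$ is the quotient of the free algebra $\mathbb C\langle x_0,\dots,x_n\rangle$ by the two-sided ideal generated by $x_jx_i-q_{ji}x_ix_j$, $0\le i<j\le n$. It is graded by length, $\mathcal A^n_{\mathbf q}=\bigoplus_k(\mathcal A^n_{\mathbf q})_k$, and the ordered monomials $T_\alpha=x_0^{\alpha_0}\cdots x_n^{\alpha_n}$ are a $\mathbb C$-basis of it; the *normal form* $\mathrm{Nor}(f)$ of $f$ is its expansion in this basis. The $d$-*Veronese subalgebra* is $(\mathcal A^n_{\mathbf q})^{(d)}=\bigoplus_k(\mathcal A^n_{\mathbf q})_{kd}$. Words are ordered degree-lexicographically, with $x_0<\dots<x_n$, and $\mathbf{LM}(f)$ is the largest ordered monomial in $\mathrm{Nor}(f)$, for $f\neq0$; $f$ is *monic* if $\mathbf{LM}(f)$ has coefficient $1$. For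 ordered monomials put $T_\alpha\star T_\beta=\mathbf{LM}(T_\alpha T_\beta)=T_{\alpha+\beta}$. A subset $F$ of a two-sided ideal $\mathfrak K$ of a quantum space is a *Gröbner basis* of $\mathfrak K$ if for every $0\ne h\in\mathfrak K$ there are $f\in F$ and an ordered monomial $u$ with $\mathbf{LM}(h)=u\star\mathbf{LM}(f)$. An ordered monomial is *normal modulo* $F$ if it is not of the form $u\star\mathbf{LM}(f)$ with $f\in F$. A Gröbner basis $G$ of $\mathfrak K$ is *reduced* if its elements are monic, $G\setminus\{f\}$ is not a Gröbner basis of $\mathfrak K$ for any $f\in G$, and every $f\in G$ is a linear combination of ordered monomials that are normal modulo $G\setminus\{f\}$. Let $n,d\ge1$ be integers and $N=\binom{n+d}{d}-1$. Let $w_0=x_0^d<w_1=x_0^{d-1}x_1<\dots<w_N=x_n^d$ be the ordered monomials of length $d$ in $x_0,\dots,x_n$, in lexicographic order. Put $$\mathrm C(n,2,d)=\{(i,j): 0\le i\le j\le N,\ \text{the word } w_iw_j \text{ is an ordered monomial}\},$$ $$\mathrm{MV}(n,d)=\{(i,j): 0\le i\le j\le N,\ \text{the word } w_iw_j \text{ is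 not an ordered monomial}\}.$$ Let $\mathbf q$ be an $(n+1)\times(n+1)$ multiplicatively anti-symmetric matrix. For all $i,j$ let $\varphi_{ij}$ be the scalar with $\mathrm{Nor}(w_iw_j)=\varphi_{ij}T_\beta$ in $\mathcal A^n_{\mathbf q}$, where $\beta$ is the multi-degree of $w_iw_j$, and let $\mathbf g=\|g_{ij}\|$ with $g_{ji}=\varphi_{ji}/\varphi_{ij}$, $0\le i,j\le N$. **Theorem.** The matrix $\mathbf g$ is the unique $(N+1)\times(N+1)$ multiplicatively anti-symmetric matrix for which the assignment $y_i\mapsto w_i$, $0\le i\le N$, extends to an algebra homomorphism $$v_{n,d}:\mathcal A^N_{\mathbf g}\to\mathcal A^n_{\mathbf q}$$ (the *Veronese map*), where $y_0,\dots,y_N$ are the generators of $\mathcal A^N_{\mathbf g}$. Moreover: 1. The image of $v_{n,d}$ is the $d$-Veronese subalgebra $(\mathcal A^n_{\mathbf q})^{(d)}$. 2. The set $$\mathcal R^{\mathrm v}_{\mathbf q}=\{\,y_iy_j-\varphi_{ij}\,y_{i'}y_{j'} : (i,j)\in\mathrm{MV}(n,d),\ (i',j')\in\mathrm C(n,2,d),\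 \mathrm{Nor}(w_iw_j)=\varphi_{ij}\,w_{i'}w_{j'}\,\}$$ is a reduced Gröbner basis of $\ker(v_{n,d})$, and it has exactly $\binom{N+2}{2}-\binom{n+2d}{n}$ elements. For every $(i,j)\in\mathrm{MV}(n,d)$ one has $\varphi_{ij}\ne0$, and there is exactly one pair $(i',j')\in\mathrm C(n,2,d)$ with $\mathrm{Nor}(v_{n,d}(y_iy_j))=\varphi_{ij}\,\mathrm{Nor}(v_{n,d}(y_{i'}y_{j'}))$ and $y_iy_j\succ y_{i'}y_{j'}$, where $\succ$ is the degree-lexicographic order on words in $y_0<\dots<y_N$. -/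

import Mathlib

namespace NCVeronese

noncomputable section

/-! ### Words and ordered monomials

The letters `x_0 < ... < x_{m-1}` are the elements of `Fin m`, and a word is a list of letters. -/

/-- The multi-degree of a word. -/
def multideg {m : ℕ} (w : List (Fin m)) : Fin m → ℕ := fun i => w.count i

/-- A word is an ordered monomial when its letters weakly increase. -/
def IsOrdered {m : ℕ} (w : List (Fin m)) : Prop := w.Pairwise (· ≤ ·)

/-- The ordered word `x_0^{α_0} x_1^{α_1} ⋯ x_{m-1}^{α_{m-1}}` of multi-degree `α`. -/
def orderedWord {m : ℕ} (α : Fin m → ℕ) : List (Fin m) :=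
  (List.finRange m).flatMap fun i => List.replicate (α i) i

/-- The strict degree-lexicographic order on words. -/
def WordLT {m : ℕ} (u v : List (Fin m)) : Prop := List.Shortlex (· < ·) u v

/-- The restriction of the degree-lexicographic order to ordered monomials, which are
encoded by their multi-degrees. -/
def TermLT {m : ℕ} (α β : Fin m → ℕ) : Prop := WordLT (orderedWord α) (orderedWord β)

theorem isOrdered_orderedWord {m : ℕ} (α : Fin m → ℕ) : IsOrdered (orderedWord α) := by
  unfold IsOrdered orderedWord
  rw [List.pairwise_flatMap]
  refine ⟨fun a _ => List.pairwise_replicate.2 (Or.inr le_rfl), ?_⟩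
  refine (List.pairwise_lt_finRange m).imp ?_
  intro a b hab x hx y hy
  rw [List.eq_of_mem_replicate hx, List.eq_of_mem_replicate hy]
  exact hab.le

theorem multideg_orderedWord {m : ℕ} (α : Fin m → ℕ) : multideg (orderedWord α) = α := by
  funext i
  unfold multideg orderedWord
  rw [List.count_flatMap]
  have h : (List.count i ∘ fun j : Fin m => List.replicate (α j) j)
      = fun j => if j = i then α j else 0 := by
    funext j
    simp [List.count_replicate]
  rw [h, ← List.ofFn_eq_map, List.sum_ofFn]
  simp

theorem eq_orderedWord {m : ℕ} {w : List (Fin m)} (hw : IsOrdered w) :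
    w = orderedWord (multideg w) := by
  refine List.Perm.eq_of_pairwise' (r := (· ≤ ·)) hw (isOrdered_orderedWord _) ?_
  rw [List.perm_iff_count]
  intro a
  exact (congrFun (multideg_orderedWord (multideg w)) a).symm

/-! ### Quantum spaces -/

/-- A square complex matrix is multiplicatively anti-symmetric when its entries are non-zero,
`q_{ji} = q_{ij}⁻¹`, and `q_{ii} = 1`. -/
structure IsMultAntisymm {m : ℕ} (q : Matrix (Fin m) (Fin m) ℂ) : Prop where
  ne_zero : ∀ i j, q i j ≠ 0
  inv : ∀ i j, q j i = (q i j)⁻¹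
  diag : ∀ i, q i i = 1

/-- The relations `x_j x_i = q_{ji} x_i x_j`, for `i < j`. -/
inductive QuantumRel {m : ℕ} (q : Matrix (Fin m) (Fin m) ℂ) :
    FreeAlgebra ℂ (Fin m) → FreeAlgebra ℂ (Fin m) → Prop
  | swap (i j : Fin m) (hij : i < j) : QuantumRel q
      (FreeAlgebra.ι ℂ j * FreeAlgebra.ι ℂ i)
      (q j i • (FreeAlgebra.ι ℂ i * FreeAlgebra.ι ℂ j))

/-- The quantum space defined by `q`: the free associative algebra modulo the two-sided ideal
generated by the relations `QuantumRel q`. The algebra written `𝒜^n_q` has `m = n + 1`. -/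
abbrev QuantumSpace {m : ℕ} (q : Matrix (Fin m) (Fin m) ℂ) : Type := RingQuot (QuantumRel q)

section General

variable {m : ℕ} (q : Matrix (Fin m) (Fin m) ℂ)

/-- The generators of the quantum space. -/
def gen (i : Fin m) : QuantumSpace q :=
  RingQuot.mkAlgHom ℂ (QuantumRel q) (FreeAlgebra.ι ℂ i)

/-- The element of the quantum space given by a word. -/
def wordElem (w : List (Fin m)) : QuantumSpace q := (w.map (gen q)).prod

/-- The ordered monomial of multi-degree `α`, as an element of the quantum space. -/
def term (α : Fin m → ℕ) : QuantumSpace q := wordElem q (orderedWord α)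

/-! ### Normal forms

The ordered monomials are a basis of the quantum space; `normalForm` is the coordinate map. -/

/-- The scalar by which `x_k T_α` differs from the ordered monomial with the same
multi-degree. -/
def leftCoeff (k : Fin m) (α : Fin m → ℕ) : ℂ := ∏ i ∈ Finset.Iio k, q k i ^ α i

/-- Left multiplication by `x_k` on the span of the ordered monomials. -/
def leftOp (k : Fin m) : Module.End ℂ ((Fin m → ℕ) →₀ ℂ) :=
  Finsupp.linearCombination ℂ fun α => Finsupp.single (α + Pi.single k 1) (leftCoeff q k α)

theorem leftOp_single (k : Fin m) (α : Fin m → ℕ) (c : ℂ) :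
    leftOp q k (Finsupp.single α c)
      = Finsupp.single (α + Pi.single k 1) (c * leftCoeff q k α) := by
  simp [leftOp]

theorem leftCoeff_add_single_of_lt {i j : Fin m} (hij : i < j) (α : Fin m → ℕ) :
    leftCoeff q j (α + Pi.single i 1) = q j i * leftCoeff q j α := by
  unfold leftCoeff
  have hi : i ∈ Finset.Iio j := Finset.mem_Iio.2 hij
  rw [← Finset.mul_prod_erase _ _ hi, ← Finset.mul_prod_erase _ _ hi, ← mul_assoc]
  congr 1
  · simp [pow_succ, mul_comm]
  · refine Finset.prod_congr rfl fun l hl => ?_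
    simp [Finset.ne_of_mem_erase hl]

theorem leftCoeff_add_single_of_le {i j : Fin m} (hij : i ≤ j) (α : Fin m → ℕ) :
    leftCoeff q i (α + Pi.single j 1) = leftCoeff q i α := by
  unfold leftCoeff
  refine Finset.prod_congr rfl fun l hl => ?_
  have hl' : l ≠ j := ((Finset.mem_Iio.1 hl).trans_le hij).ne
  simp [hl']

/-- The left regular representation of the quantum space on the span of the ordered monomials. -/
def leftRep : QuantumSpace q →ₐ[ℂ] Module.End ℂ ((Fin m → ℕ) →₀ ℂ) :=
  RingQuot.liftAlgHom ℂ ⟨FreeAlgebra.lift ℂ (leftOp q), by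
    rintro _ _ ⟨i, j, hij⟩
    simp only [map_mul, map_smul, FreeAlgebra.lift_ι_apply]
    refine Finsupp.lhom_ext fun α c => ?_
    simp only [Module.End.mul_apply, LinearMap.smul_apply, leftOp_single, Finsupp.smul_single,
      leftCoeff_add_single_of_lt q hij, leftCoeff_add_single_of_le q hij.le, smul_eq_mul]
    rw [add_right_comm]
    congr 1
    ring⟩

theorem leftRep_gen (k : Fin m) : leftRep q (gen q k) = leftOp q k := by
  unfold leftRep gen
  rw [RingQuot.liftAlgHom_mkAlgHom_apply, FreeAlgebra.lift_ι_apply]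

theorem multideg_cons (k : Fin m) (w : List (Fin m)) :
    multideg (k :: w) = multideg w + Pi.single k 1 := by
  funext i
  by_cases h : i = k
  · subst h
    simp [multideg]
  · simp [multideg, h, Ne.symm h]

theorem leftCoeff_eq_one {k : Fin m} {w : List (Fin m)} (h : ∀ a ∈ w, k ≤ a) :
    leftCoeff q k (multideg w) = 1 := by
  unfold leftCoeff
  refine Finset.prod_eq_one fun l hl => ?_
  have : w.count l = 0 := List.count_eq_zero.2 fun hm =>
    absurd (h l hm) (not_le.2 (Finset.mem_Iio.1 hl))
  simp [multideg, this]

theorem leftRep_wordElem {w : List (Fin m)} (hw : IsOrdered w) :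
    leftRep q (wordElem q w) (Finsupp.single 0 1) = Finsupp.single (multideg w) 1 := by
  induction w with
  | nil =>
    have : multideg ([] : List (Fin m)) = 0 := by funext i; simp [multideg]
    simp [wordElem, this]
  | cons k w ih =>
    have h := List.pairwise_cons.1 hw
    have e : wordElem q (k :: w) = gen q k * wordElem q w := by simp [wordElem]
    rw [e, map_mul, Module.End.mul_apply, ih h.2, leftRep_gen, leftOp_single,
      leftCoeff_eq_one q h.1, multideg_cons, mul_one]

theorem gen_mul_gen {i j : Fin m} (hij : i < j) :
    gen q j * gen q i = q j i • (gen q i * gen q j) := by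
  unfold gen
  rw [← map_mul, ← map_mul, ← map_smul]
  exact RingQuot.mkAlgHom_rel ℂ (QuantumRel.swap i j hij)

theorem gen_mul_wordElem (k : Fin m) {w : List (Fin m)} (hw : IsOrdered w) :
    gen q k * wordElem q w
      = leftCoeff q k (multideg w) • wordElem q (w.orderedInsert (· ≤ ·) k) := by
  induction w with
  | nil =>
    have : leftCoeff q k (multideg []) = 1 := leftCoeff_eq_one q (by simp)
    simp [wordElem, this]
  | cons a w ih =>
    have h := List.pairwise_cons.1 hw
    by_cases hk : k ≤ a
    · have h1 : leftCoeff q k (multideg (a :: w)) = 1 := by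
        refine leftCoeff_eq_one q fun b hb => ?_
        rcases List.mem_cons.1 hb with rfl | hb
        · exact hk
        · exact hk.trans (h.1 b hb)
      rw [h1, List.orderedInsert_cons_of_le _ _ hk, one_smul]
      simp [wordElem]
    · have hak : a < k := not_le.1 hk
      rw [List.orderedInsert_of_not_le _ _ hk, multideg_cons, leftCoeff_add_single_of_lt q hak]
      have e : ∀ (b : Fin m) v, wordElem q (b :: v) = gen q b * wordElem q v := by
        intro b v; simp [wordElem]
      rw [e, e, ← mul_assoc, gen_mul_gen q hak, smul_mul_assoc, mul_assoc, ih h.2,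
        mul_smul_comm, smul_smul]

theorem gen_mul_term (k : Fin m) (α : Fin m → ℕ) :
    gen q k * term q α = leftCoeff q k α • term q (α + Pi.single k 1) := by
  unfold term
  have hα := isOrdered_orderedWord α
  rw [gen_mul_wordElem q k hα, multideg_orderedWord]
  have ho : IsOrdered ((orderedWord α).orderedInsert (· ≤ ·) k) := hα.orderedInsert k _
  have hd : multideg ((orderedWord α).orderedInsert (· ≤ ·) k) = α + Pi.single k 1 := by
    rw [← multideg_orderedWord α, ← multideg_cons, multideg_orderedWord]
    funext i
    exact (List.perm_orderedInsert _ k _).count_eq i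
  rw [eq_orderedWord ho, hd]

/-- The linear map sending a formal combination of ordered monomials to the element of the
quantum space that it represents. -/
def ofNormal : ((Fin m → ℕ) →₀ ℂ) →ₗ[ℂ] QuantumSpace q :=
  Finsupp.linearCombination ℂ (term q)

theorem ofNormal_leftRep (f : QuantumSpace q) (p : (Fin m → ℕ) →₀ ℂ) :
    ofNormal q (leftRep q f p) = f * ofNormal q p := by
  obtain ⟨a, rfl⟩ := RingQuot.mkAlgHom_surjective ℂ (QuantumRel q) f
  induction a using FreeAlgebra.induction generalizing p with
  | grade0 r => simp [Algebra.algebraMap_eq_smul_one]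
  | grade1 k =>
    change ofNormal q (leftRep q (gen q k) p) = gen q k * ofNormal q p
    rw [leftRep_gen]
    induction p using Finsupp.induction_linear with
    | zero => simp
    | add f g hf hg => simp only [map_add, mul_add, hf, hg]
    | single α c =>
      rw [leftOp_single]
      unfold ofNormal
      rw [Finsupp.linearCombination_single, Finsupp.linearCombination_single, mul_smul_comm,
        gen_mul_term, smul_smul]
  | mul a b ha hb => rw [map_mul, map_mul, Module.End.mul_apply, ha, hb, mul_assoc]
  | add a b ha hb => simp only [map_add, LinearMap.add_apply, ha, hb, add_mul]

/-- The identification of the quantum space with the span of the ordered monomials: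
`normalForm q f α` is the coefficient of the ordered monomial `T_α` in the normal form of `f`. -/
def normalForm : QuantumSpace q ≃ₗ[ℂ] ((Fin m → ℕ) →₀ ℂ) where
  toFun f := leftRep q f (Finsupp.single 0 1)
  map_add' f g := by simp
  map_smul' c f := by simp
  invFun := ofNormal q
  left_inv f := by
    have h0 : orderedWord (0 : Fin m → ℕ) = [] := by simp [orderedWord]
    change ofNormal q (leftRep q f (Finsupp.single 0 1)) = f
    rw [ofNormal_leftRep]
    simp [ofNormal, term, wordElem, h0]
  right_inv p := by
    change leftRep q (ofNormal q p) (Finsupp.single 0 1) = p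
    induction p using Finsupp.induction_linear with
    | zero => simp
    | add f g hf hg => simp only [map_add, LinearMap.add_apply, hf, hg]
    | single α c =>
      simp [ofNormal, term, leftRep_wordElem q (isOrdered_orderedWord α), multideg_orderedWord]

theorem normalForm_term (α : Fin m → ℕ) : normalForm q (term q α) = Finsupp.single α 1 := by
  have h := leftRep_wordElem q (isOrdered_orderedWord α)
  rwa [multideg_orderedWord] at h

/-- Up to a non-zero scalar, ordered monomials multiply by adding their multi-degrees. -/
theorem term_mul_term (hq : IsMultAntisymm q) (α β : Fin m → ℕ) :
    ∃ c : ℂ, c ≠ 0 ∧ term q α * term q β = c • term q (α + β) := by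
  have key : ∀ w : List (Fin m), ∃ c : ℂ, c ≠ 0 ∧
      wordElem q w * term q β = c • term q (multideg w + β) := by
    intro w
    induction w with
    | nil =>
      have : multideg ([] : List (Fin m)) = 0 := by funext i; simp [multideg]
      exact ⟨1, one_ne_zero, by simp [wordElem, this]⟩
    | cons k w ih =>
      obtain ⟨c, hc, e⟩ := ih
      refine ⟨c * leftCoeff q k (multideg w + β), mul_ne_zero hc
        (Finset.prod_ne_zero_iff.2 fun i _ => pow_ne_zero _ (hq.ne_zero k i)), ?_⟩
      have e' : wordElem q (k :: w) = gen q k * wordElem q w := by simp [wordElem]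
      rw [e', mul_assoc, e, mul_smul_comm, gen_mul_term, smul_smul, multideg_cons,
        add_right_comm]
  have h := key (orderedWord α)
  rwa [multideg_orderedWord] at h

/-! ### Gröbner bases in a quantum space -/

/-- `T_α` is the leading monomial of `f`. -/
def IsLM (f : QuantumSpace q) (α : Fin m → ℕ) : Prop :=
  α ∈ (normalForm q f).support ∧ ∀ β ∈ (normalForm q f).support, β ≠ α → TermLT β α

/-- `F` is a Gröbner basis of the two-sided ideal `K`: `F ⊆ K`, and the leading monomial of every
non-zero element of `K` is of the form `u ⋆ LM(f)` with `f ∈ F` and `u` an ordered monomial. Here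
`u ⋆ v` is the leading monomial of the product of the ordered monomials `u` and `v`; its
multi-degree is the sum of those of `u` and `v`, by `term_mul_term`. -/
def IsGroebnerBasis (K : TwoSidedIdeal (QuantumSpace q)) (F : Set (QuantumSpace q)) : Prop :=
  (∀ f ∈ F, f ∈ K) ∧
    ∀ h ∈ K, h ≠ 0 → ∃ f ∈ F, ∃ α β u, IsLM q h α ∧ IsLM q f β ∧ α = u + β

/-- The ordered monomial `T_α` is normal modulo `F`: no leading monomial of an element of `F`
divides it. -/
def IsNormalMod (F : Set (QuantumSpace q)) (α : Fin m → ℕ) : Prop :=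
  ∀ f ∈ F, ∀ β, IsLM q f β → ¬ ∃ u, α = u + β

/-- `f` is monic: its leading monomial has coefficient `1`. -/
def IsMonic (f : QuantumSpace q) : Prop := ∃ α, IsLM q f α ∧ normalForm q f α = 1

/-- `G` is a reduced Gröbner basis of `K`: a Gröbner basis that consists of monic elements, is
minimal, and in which every `f` is a combination of monomials normal modulo `G \ {f}`. -/
structure IsReducedGroebnerBasis (K : TwoSidedIdeal (QuantumSpace q))
    (G : Set (QuantumSpace q)) : Prop where
  groebner : IsGroebnerBasis q K G
  monic : ∀ f ∈ G, IsMonic q f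
  minimal : ∀ f ∈ G, ¬ IsGroebnerBasis q K (G \ {f})
  reduced : ∀ f ∈ G, ∀ α ∈ (normalForm q f).support, IsNormalMod q (G \ {f}) α

/-! ### The Veronese subalgebra -/

/-- The component of degree `k` of the quantum space, spanned by the words of length `k`. -/
def gradedPiece (k : ℕ) : Submodule ℂ (QuantumSpace q) :=
  Submodule.span ℂ {f | ∃ w : List (Fin m), w.length = k ∧ f = wordElem q w}

theorem gradedPiece_mul {a b : ℕ} {f g : QuantumSpace q} (hf : f ∈ gradedPiece q a)
    (hg : g ∈ gradedPiece q b) : f * g ∈ gradedPiece q (a + b) := by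
  have h := Submodule.mul_mem_mul hf hg
  unfold gradedPiece at h ⊢
  rw [Submodule.span_mul_span] at h
  refine Submodule.span_mono ?_ h
  rintro _ ⟨_, ⟨u, hu, rfl⟩, _, ⟨v, hv, rfl⟩, rfl⟩
  exact ⟨u ++ v, by simp [hu, hv], by simp [wordElem]⟩

/-- The `d`-Veronese subalgebra: the sum of the components whose degree is a multiple of `d`. -/
def veroneseSubalgebra (d : ℕ) : Subalgebra ℂ (QuantumSpace q) :=
  (⨆ k : ℕ, gradedPiece q (k * d)).toSubalgebra
    (by
      refine Submodule.mem_iSup_of_mem 0 (Submodule.subset_span ⟨[], by simp, ?_⟩)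
      simp [wordElem])
    (by
      intro f g hf hg
      have h := Submodule.mul_mem_mul hf hg
      rw [Submodule.iSup_mul] at h
      refine (iSup_le fun a => ?_ : _ ≤ ⨆ k : ℕ, gradedPiece q (k * d)) h
      rw [Submodule.mul_iSup]
      refine iSup_le fun b => Submodule.mul_le.2 fun x hx y hy => ?_
      refine Submodule.mem_iSup_of_mem (a + b) ?_
      rw [add_mul]
      exact gradedPiece_mul q hx hy)

end General

/-! ### The monomials of degree `d` -/

/-- The finite set of the ordered words of length `d` in the letters `x_0, ..., x_n`. -/
def orderedWords (n d : ℕ) : Finset (List (Fin (n + 1))) :=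
  (Finset.univ : Finset (Sym (Fin (n + 1)) d)).image fun s => s.1.sort (· ≤ ·)

theorem mem_orderedWords {n d : ℕ} {w : List (Fin (n + 1))} :
    w ∈ orderedWords n d ↔ IsOrdered w ∧ w.length = d := by
  unfold orderedWords IsOrdered
  simp only [Finset.mem_image, Finset.mem_univ, true_and]
  constructor
  · rintro ⟨s, rfl⟩
    exact ⟨Multiset.pairwise_sort _ _, by simp⟩
  · rintro ⟨hw, hl⟩
    refine ⟨⟨(w : Multiset (Fin (n + 1))), by simpa using hl⟩, ?_⟩
    refine List.Perm.eq_of_pairwise' (r := (· ≤ ·)) (Multiset.pairwise_sort _ _) hw ?_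
    exact Multiset.coe_eq_coe.1 (Multiset.sort_eq _ _)

/-- The number `N = C(n+d, d) - 1`. -/
def numN (n d : ℕ) : ℕ := (n + d).choose d - 1

theorem card_orderedWords (n d : ℕ) : (orderedWords n d).card = numN n d + 1 := by
  have hpos : 0 < (n + d).choose d := Nat.choose_pos (by omega)
  unfold orderedWords numN
  rw [Finset.card_image_of_injective, Finset.card_univ, Sym.card_sym_eq_choose, Fintype.card_fin]
  · have : n + 1 + d - 1 = n + d := by omega
    rw [this]
    omega
  · intro s t h
    apply Subtype.ext
    have h' := congrArg (fun l : List (Fin (n + 1)) => (l : Multiset (Fin (n + 1)))) h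
    simpa [Multiset.sort_eq] using h'

/-- The ordered words of length `d`, enumerated increasingly in the lexicographic order:
`w_0 = x_0^d < w_1 = x_0^{d-1} x_1 < ... < w_N = x_n^d`. -/
def wWord (n d : ℕ) : Fin (numN n d + 1) ↪o List (Fin (n + 1)) :=
  (orderedWords n d).orderEmbOfFin (card_orderedWords n d)

/-- The set `C(n,2,d)` of the pairs `i ≤ j` for which the word `w_i w_j` is ordered. -/
def setC (n d : ℕ) : Set (Fin (numN n d + 1) × Fin (numN n d + 1)) :=
  {p | p.1 ≤ p.2 ∧ IsOrdered (wWord n d p.1 ++ wWord n d p.2)}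

/-- The set `MV(n,d)` of the pairs `i ≤ j` for which the word `w_i w_j` is not ordered. -/
def setMV (n d : ℕ) : Set (Fin (numN n d + 1) × Fin (numN n d + 1)) :=
  {p | p.1 ≤ p.2 ∧ ¬ IsOrdered (wWord n d p.1 ++ wWord n d p.2)}

/-! ### The data of the Veronese map -/

section Veronese

variable {n : ℕ} (q : Matrix (Fin (n + 1)) (Fin (n + 1)) ℂ) (d : ℕ)

/-- The monomial `w_i` as an element of the quantum space. -/
def wElem (i : Fin (numN n d + 1)) : QuantumSpace q := wordElem q (wWord n d i)

/-- The scalar `φ_{ij}` with `w_i w_j = φ_{ij} T_β` in the quantum space, where `T_β` is the ordered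
monomial with the multi-degree of the word `w_i w_j`. -/
def phi (i j : Fin (numN n d + 1)) : ℂ :=
  normalForm q (wElem q d i * wElem q d j) (multideg (wWord n d i ++ wWord n d j))

/-- The matrix `g` with entries `g_{ji} = φ_{ji} / φ_{ij}`. -/
def gMatrix : Matrix (Fin (numN n d + 1)) (Fin (numN n d + 1)) ℂ :=
  fun j i => phi q d j i / phi q d i j

/-- The binomials `y_i y_j - φ_{ij} y_{i'} y_{j'}` in the quantum space defined by `g`, where
`(i, j) ∈ MV(n,d)`, `(i', j') ∈ C(n,2,d)` and the normal form of `w_i w_j` is `φ_{ij}` times the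
ordered monomial `w_{i'} w_{j'}`. -/
def veroneseBinomials : Set (QuantumSpace (gMatrix q d)) :=
  {f | ∃ i j i' j', (i, j) ∈ setMV n d ∧ (i', j') ∈ setC n d ∧
    normalForm q (wElem q d i * wElem q d j)
      = Finsupp.single (multideg (wWord n d i' ++ wWord n d j')) (phi q d i j) ∧
    f = gen (gMatrix q d) i * gen (gMatrix q d) j
      - phi q d i j • (gen (gMatrix q d) i' * gen (gMatrix q d) j')}

end Veronese

end

end NCVeronese

open NCVeronese

open NCVeronese

/-!
In a quantum space every word is a non-zero multiple of the ordered monomial with the same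
multi-degree (`exists_wordElem_eq_smul_term`). Hence `w_j w_i` and `w_i w_j` differ by a scalar,
which can only be `g_{ji} = φ_{ji} / φ_{ij}`; this gives the Veronese map and the uniqueness of its
source. Its image is the Veronese subalgebra because a word whose length is a multiple of `d` can be
cut into pieces of length `d`, each of which is a multiple of some `w_i`.

The kernel is governed by one combinatorial fact. A word `u` in the letters `y_i` is expanded to a
word in the letters `x_k` by `y_i ↦ w_i`. As all `w_i` have length `d` and increase with `i`, this
expansion preserves the degree-lexicographic order; and an ordered word is the smallest among its
rearrangements. So a word whose expansion is ordered is the smallest among the words whose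
expansions have the same multi-degree (`not_wordLT_of_isOrdered_expand`).

The fact is used twice. For words of length two, it shows that the pair of `C(n,2,d)` with the
multi-degree of a pair `(i, j)` of `MV(n,d)` precedes it, so that the leading monomial of a Veronese
binomial is `y_i y_j`. For words of any length, it shows that an element `h` of the kernel cannot
have a leading monomial `T_α` with ordered expansion: no other monomial of `h` maps to the
multi-degree of that expansion, so nothing cancels the image of `T_α`
(`not_isOrdered_expand_of_isLM`). If the expansion of `T_α` is not ordered, then two of its letters
form a pair in `MV(n,d)`, and `T_α` is divisible by the leading monomial of a binomial.

The binomials are therefore as many as the pairs in `MV(n,d)`. The pairs of `MV(n,d)` and `C(n,2,d)`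
together are all pairs `i ≤ j`, and the pairs in `C(n,2,d)` correspond to the ordered words of
length `2d`.
-/

namespace NCVeronese

/-! ### Lexicographic comparison of words -/

section Lex

variable {ι α : Type*} [LinearOrder ι] [LinearOrder α]

theorem lex_append_of_lex {a b : List α} (h : List.Lex (· < ·) a b) (hl : a.length = b.length)
    (c c' : List α) : List.Lex (· < ·) (a ++ c) (b ++ c') := by
  induction h with
  | nil => simp at hl
  | cons h ih => exact List.Lex.cons (ih (by simpa using hl))
  | rel h => exact List.Lex.rel h

/-- Substituting words of a fixed length for letters preserves the lexicographic order on words of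
equal length, when the substitution is increasing. -/
theorem lex_flatMap {φ : ι → List α} {d : ℕ} (hlen : ∀ i, (φ i).length = d)
    (hmono : ∀ i j, i < j → List.Lex (· < ·) (φ i) (φ j)) {u v : List ι}
    (h : List.Lex (· < ·) u v) (hl : u.length = v.length) :
    List.Lex (· < ·) (u.flatMap φ) (v.flatMap φ) := by
  induction h with
  | nil => simp at hl
  | cons h ih =>
    rw [List.flatMap_cons, List.flatMap_cons]
    exact List.Lex.append_left _ (ih (by simpa using hl)) _
  | rel h =>
    rw [List.flatMap_cons, List.flatMap_cons]
    exact lex_append_of_lex (hmono _ _ h) (by rw [hlen, hlen]) _ _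

/-- A weakly increasing word is the smallest one among its rearrangements. -/
theorem not_lex_of_perm_of_pairwise {u v : List α} (hu : u.Pairwise (· ≤ ·)) (h : v.Perm u) :
    ¬ List.Lex (· < ·) v u := by
  intro hlt
  induction hlt with
  | nil => exact absurd h.length_eq (by simp)
  | cons _ ih => exact ih hu.of_cons ((List.perm_cons _).1 h)
  | @rel a _ b _ hab =>
    have ha := h.subset (List.mem_cons_self (a := a))
    rcases List.mem_cons.1 ha with rfl | ha
    · exact lt_irrefl _ hab
    · exact absurd ((List.pairwise_cons.1 hu).1 a ha) (not_le.2 hab)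

end Lex

/-! ### Multi-degrees and leading monomials -/

section Words

variable {m : ℕ}

theorem multideg_append (u v : List (Fin m)) :
    multideg (u ++ v) = multideg u + multideg v := by
  funext i
  simp [multideg]

theorem multideg_append_comm {m : ℕ} (u v : List (Fin m)) :
    multideg (u ++ v) = multideg (v ++ u) := by
  rw [multideg_append, multideg_append, add_comm]

theorem multideg_eq_iff_perm {u v : List (Fin m)} : multideg u = multideg v ↔ u.Perm v := by
  rw [List.perm_iff_count]
  exact funext_iff

theorem eq_of_isOrdered_of_multideg_eq {u v : List (Fin m)} (hu : IsOrdered u)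
    (hv : IsOrdered v) (h : multideg u = multideg v) : u = v := by
  rw [eq_orderedWord hu, eq_orderedWord hv, h]

theorem orderedWord_injective : Function.Injective (orderedWord (m := m)) := fun α β h => by
  rw [← multideg_orderedWord α, h, multideg_orderedWord]

theorem TermLT.asymm {α β : Fin m → ℕ} (h : TermLT α β) : ¬ TermLT β α :=
  Std.Asymm.asymm (r := List.Shortlex (· < ·)) _ _ h

theorem termLT_multideg {u v : List (Fin m)} (hu : IsOrdered u) (hv : IsOrdered v) :
    TermLT (multideg u) (multideg v) ↔ WordLT u v := by
  unfold TermLT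
  rw [← eq_orderedWord hu, ← eq_orderedWord hv]

theorem wordElem_append (q : Matrix (Fin m) (Fin m) ℂ) (u v : List (Fin m)) :
    wordElem q (u ++ v) = wordElem q u * wordElem q v := by
  simp [wordElem]

theorem wordElem_eq_term (q : Matrix (Fin m) (Fin m) ℂ) {w : List (Fin m)} (hw : IsOrdered w) :
    wordElem q w = term q (multideg w) := by
  rw [term, ← eq_orderedWord hw]

theorem normalForm_wordElem_of_isOrdered (q : Matrix (Fin m) (Fin m) ℂ) {w : List (Fin m)}
    (hw : IsOrdered w) : normalForm q (wordElem q w) = Finsupp.single (multideg w) 1 := by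
  rw [wordElem_eq_term q hw, normalForm_term]

/-- Every word is a non-zero multiple of the ordered monomial with the same multi-degree. -/
theorem exists_wordElem_eq_smul_term {q : Matrix (Fin m) (Fin m) ℂ} (hq : IsMultAntisymm q)
    (w : List (Fin m)) : ∃ c : ℂ, c ≠ 0 ∧ wordElem q w = c • term q (multideg w) := by
  induction w with
  | nil =>
    exact ⟨1, one_ne_zero, by rw [one_smul, wordElem_eq_term q (by simp [IsOrdered])]⟩
  | cons k w ih =>
    obtain ⟨c, hc, e⟩ := ih
    refine ⟨c * leftCoeff q k (multideg w), mul_ne_zero hc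
      (Finset.prod_ne_zero_iff.2 fun i _ => pow_ne_zero _ (hq.ne_zero k i)), ?_⟩
    have e' : wordElem q (k :: w) = gen q k * wordElem q w := by simp [wordElem]
    rw [e', e, mul_smul_comm, gen_mul_term, smul_smul, multideg_cons]

theorem eq_linearCombination_term (q : Matrix (Fin m) (Fin m) ℂ) (f : QuantumSpace q) :
    f = (normalForm q f).sum fun α c => c • term q α :=
  ((normalForm q).symm_apply_apply f).symm

theorem IsLM.unique {q : Matrix (Fin m) (Fin m) ℂ} {f : QuantumSpace q} {α β : Fin m → ℕ}
    (hα : IsLM q f α) (hβ : IsLM q f β) : α = β := by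
  by_contra h
  exact (hα.2 β hβ.1 (Ne.symm h)).asymm (hβ.2 α hα.1 h)

theorem exists_isLM {q : Matrix (Fin m) (Fin m) ℂ} {f : QuantumSpace q} (hf : f ≠ 0) :
    ∃ α, IsLM q f α := by
  have hne : (normalForm q f).support.Nonempty := by
    rw [Finsupp.support_nonempty_iff]
    exact (normalForm q).map_ne_zero_iff.2 hf
  obtain ⟨α, hα, hmax⟩ := Finset.exists_max_image _
    (fun α => toLex ((orderedWord α).length, orderedWord α)) hne
  refine ⟨α, hα, fun β hβ hβα => ?_⟩
  have hlt := lt_of_le_of_ne (hmax β hβ) fun h =>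
    hβα (orderedWord_injective (congrArg (fun x => (ofLex x).2) h))
  exact List.shortlex_def.2 (Prod.Lex.toLex_lt_toLex.1 hlt)

end Words

/-! ### The ordered words of length `d` -/

section Blocks

variable {n d : ℕ}

theorem isOrdered_wWord (i : Fin (numN n d + 1)) : IsOrdered (wWord n d i) :=
  (mem_orderedWords.1 (Finset.orderEmbOfFin_mem _ (card_orderedWords n d) i)).1

theorem length_wWord (i : Fin (numN n d + 1)) : (wWord n d i).length = d :=
  (mem_orderedWords.1 (Finset.orderEmbOfFin_mem _ (card_orderedWords n d) i)).2

theorem exists_wWord_eq {w : List (Fin (n + 1))} (hw : IsOrdered w) (hl : w.length = d) :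
    ∃ i, wWord n d i = w := by
  have h : w ∈ Set.range (wWord n d) := by
    unfold wWord
    rw [Finset.range_orderEmbOfFin]
    exact mem_orderedWords.2 ⟨hw, hl⟩
  exact h

/-- The word in the letters `x_0, ..., x_n` obtained from a word in `y_0, ..., y_N` by the
substitution `y_i ↦ w_i`. -/
def expand (n d : ℕ) (u : List (Fin (numN n d + 1))) : List (Fin (n + 1)) :=
  u.flatMap (wWord n d)

theorem expand_pair (i j : Fin (numN n d + 1)) :
    expand n d [i, j] = wWord n d i ++ wWord n d j := by
  simp [expand]

theorem length_expand (u : List (Fin (numN n d + 1))) :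
    (expand n d u).length = u.length * d := by
  induction u with
  | nil => simp [expand]
  | cons i u ih =>
    have : expand n d (i :: u) = wWord n d i ++ expand n d u := by simp [expand]
    rw [this, List.length_append, length_wWord, ih, List.length_cons, Nat.add_mul, one_mul,
      add_comm]

theorem lex_expand {u v : List (Fin (numN n d + 1))} (h : List.Lex (· < ·) u v)
    (hl : u.length = v.length) : List.Lex (· < ·) (expand n d u) (expand n d v) :=
  lex_flatMap length_wWord (fun _ _ hij => (wWord n d).strictMono hij) h hl

/-- A word whose expansion is ordered is minimal among the words whose expansions have the same
multi-degree. -/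
theorem not_wordLT_of_isOrdered_expand (hd : 1 ≤ d) {u v : List (Fin (numN n d + 1))}
    (hv : IsOrdered (expand n d v))
    (h : multideg (expand n d u) = multideg (expand n d v)) : ¬ WordLT u v := by
  intro hlt
  have hp := multideg_eq_iff_perm.1 h
  have hl : u.length = v.length := by
    have := hp.length_eq
    rw [length_expand, length_expand] at this
    exact Nat.eq_of_mul_eq_mul_right hd this
  exact not_lex_of_perm_of_pairwise hv hp (lex_expand ((List.shortlex_iff_lex hl).1 hlt) hl)

theorem le_of_isOrdered_append (hd : 1 ≤ d) {i j : Fin (numN n d + 1)}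
    (h : IsOrdered (wWord n d i ++ wWord n d j)) : i ≤ j := by
  by_contra hij
  rw [← expand_pair] at h
  refine not_wordLT_of_isOrdered_expand hd (u := [j, i]) h ?_
    (List.Shortlex.of_lex rfl (List.Lex.rel (not_le.1 hij)))
  rw [expand_pair, expand_pair, multideg_append_comm]

theorem isOrdered_pair {i j : Fin (numN n d + 1)} : IsOrdered [i, j] ↔ i ≤ j := by
  simp [IsOrdered]

/-- The expansion of an ordered word is ordered when each pair of its letters has an ordered
expansion. -/
theorem isOrdered_expand {u : List (Fin (numN n d + 1))}
    (h : u.Pairwise fun i j => IsOrdered (wWord n d i ++ wWord n d j)) :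
    IsOrdered (expand n d u) := by
  refine List.pairwise_flatMap.2 ⟨fun i _ => isOrdered_wWord i, h.imp fun hij => ?_⟩
  exact (List.pairwise_append.1 hij).2.2

/-- Every ordered word of length `2d` splits in exactly one way into two ordered words of
length `d`. -/
theorem existsUnique_setC (hd : 1 ≤ d) {w : List (Fin (n + 1))} (hl : w.length = d + d) :
    ∃! p : Fin (numN n d + 1) × Fin (numN n d + 1), p ∈ setC n d ∧
      multideg (wWord n d p.1 ++ wWord n d p.2) = multideg w := by
  have ho := isOrdered_orderedWord (multideg w)
  have hlen : (orderedWord (multideg w)).length = d + d := by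
    rw [← hl]
    exact (multideg_eq_iff_perm.1 (multideg_orderedWord (multideg w))).length_eq
  obtain ⟨i, hi⟩ := exists_wWord_eq (d := d) (List.Pairwise.take (i := d) ho) (by simp [hlen])
  obtain ⟨j, hj⟩ := exists_wWord_eq (d := d) (List.Pairwise.drop (i := d) ho) (by simp [hlen])
  have hij : wWord n d i ++ wWord n d j = orderedWord (multideg w) := by
    rw [hi, hj, List.take_append_drop]
  have ho' : IsOrdered (wWord n d i ++ wWord n d j) := hij ▸ ho
  have hdeg : multideg (wWord n d i ++ wWord n d j) = multideg w := by
    rw [hij, multideg_orderedWord]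
  refine ⟨(i, j), ⟨⟨le_of_isOrdered_append hd ho', ho'⟩, hdeg⟩, ?_⟩
  rintro ⟨k, l⟩ ⟨⟨-, hkl⟩, hdeg'⟩
  have h := eq_of_isOrdered_of_multideg_eq hkl ho' (hdeg'.trans hdeg.symm)
  obtain ⟨h1, h2⟩ := List.append_inj h (by rw [length_wWord, length_wWord])
  exact Prod.ext ((wWord n d).injective h1) ((wWord n d).injective h2)

/-- The pair of `C(n,2,d)` with the multi-degree of a pair of `MV(n,d)` is the smaller of the
two. -/
theorem wordLT_of_setC_of_setMV (hd : 1 ≤ d) {i j i' j' : Fin (numN n d + 1)}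
    (h : (i, j) ∈ setMV n d) (h' : (i', j') ∈ setC n d)
    (hdeg : multideg (wWord n d i' ++ wWord n d j') = multideg (wWord n d i ++ wWord n d j)) :
    WordLT [i', j'] [i, j] := by
  by_contra hlt
  rw [← expand_pair, ← expand_pair] at hdeg
  have hC : IsOrdered (expand n d [i', j']) := by rw [expand_pair]; exact h'.2
  have hgt : ¬ WordLT [i, j] [i', j'] := not_wordLT_of_isOrdered_expand hd hC hdeg.symm
  have heq := Std.Trichotomous.trichotomous (r := List.Shortlex (· < ·)) _ _ hlt hgt
  rw [heq, expand_pair] at hC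
  exact h.2 hC

theorem ncard_setC (hd : 1 ≤ d) : (setC n d).ncard = (n + 2 * d).choose n := by
  have hbij : Set.BijOn (fun p : Fin (numN n d + 1) × Fin (numN n d + 1) =>
      wWord n d p.1 ++ wWord n d p.2) (setC n d) (orderedWords n (d + d)) := by
    refine ⟨?_, ?_, ?_⟩
    · rintro ⟨i, j⟩ ⟨-, h⟩
      exact mem_orderedWords.2 ⟨h, by simp [length_wWord]⟩
    · rintro ⟨i, j⟩ hij ⟨k, l⟩ hkl h
      exact (existsUnique_setC hd (w := wWord n d k ++ wWord n d l)
        (by simp [length_wWord])).unique ⟨hij, congrArg multideg h⟩ ⟨hkl, rfl⟩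
    · intro w hw
      obtain ⟨ho, hl⟩ := mem_orderedWords.1 (Finset.mem_coe.1 hw)
      obtain ⟨p, ⟨hp, hdeg⟩, -⟩ := existsUnique_setC hd hl
      exact ⟨p, hp, eq_of_isOrdered_of_multideg_eq hp.2 ho hdeg⟩
  rw [hbij.ncard_eq, Set.ncard_coe_finset, card_orderedWords, numN, Nat.sub_add_cancel
    (Nat.choose_pos (by omega)), ← two_mul]
  exact (Nat.choose_symm_add).symm

theorem ncard_setMV_add_ncard_setC :
    (setMV n d).ncard + (setC n d).ncard = (numN n d + 2).choose 2 := by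
  have hdisj : Disjoint (setMV n d) (setC n d) :=
    Set.disjoint_left.2 fun p hp hp' => hp.2 hp'.2
  have hunion : setMV n d ∪ setC n d = {p | p.1 ≤ p.2} := by
    ext p
    by_cases h : IsOrdered (wWord n d p.1 ++ wWord n d p.2) <;> simp [setMV, setC, h]
  rw [← Set.ncard_union_eq hdisj, hunion, ← Nat.card_coe_set_eq]
  refine (Nat.card_congr (Sym2.sortEquiv (α := Fin (numN n d + 1))).symm).trans ?_
  rw [Nat.card_eq_fintype_card, Sym2.card, Fintype.card_fin]

end Blocks

/-! ### The scalars `φ` and the Veronese map -/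

section VeroneseMap

variable {n d : ℕ} {q : Matrix (Fin (n + 1)) (Fin (n + 1)) ℂ}

theorem wElem_mul_wElem (i j : Fin (numN n d + 1)) :
    wElem q d i * wElem q d j = wordElem q (wWord n d i ++ wWord n d j) :=
  (wordElem_append q _ _).symm

theorem wElem_mul_wElem_eq_smul_term (hq : IsMultAntisymm q) (i j : Fin (numN n d + 1)) :
    wElem q d i * wElem q d j
      = phi q d i j • term q (multideg (wWord n d i ++ wWord n d j)) := by
  obtain ⟨c, -, e⟩ := exists_wordElem_eq_smul_term hq (wWord n d i ++ wWord n d j)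
  rw [← wElem_mul_wElem] at e
  have hphi : phi q d i j = c := by
    rw [phi, e, map_smul, normalForm_term]
    simp
  rw [hphi, e]

theorem phi_ne_zero (hq : IsMultAntisymm q) (i j : Fin (numN n d + 1)) : phi q d i j ≠ 0 := by
  obtain ⟨c, hc, e⟩ := exists_wordElem_eq_smul_term hq (wWord n d i ++ wWord n d j)
  rw [phi, wElem_mul_wElem, e, map_smul, normalForm_term]
  simpa using hc

theorem normalForm_wElem_mul_wElem (hq : IsMultAntisymm q) (i j : Fin (numN n d + 1)) :
    normalForm q (wElem q d i * wElem q d j)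
      = Finsupp.single (multideg (wWord n d i ++ wWord n d j)) (phi q d i j) := by
  rw [wElem_mul_wElem_eq_smul_term hq, map_smul, normalForm_term, Finsupp.smul_single,
    smul_eq_mul, mul_one]

theorem isMultAntisymm_gMatrix (hq : IsMultAntisymm q) : IsMultAntisymm (gMatrix q d) where
  ne_zero i j := div_ne_zero (phi_ne_zero hq i j) (phi_ne_zero hq j i)
  inv _ _ := (inv_div _ _).symm
  diag i := div_self (phi_ne_zero hq i i)

/-- The monomials `w_i` satisfy the relations of the quantum space defined by `g`. -/
theorem wElem_mul_wElem_comm (hq : IsMultAntisymm q) (i j : Fin (numN n d + 1)) :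
    wElem q d j * wElem q d i = gMatrix q d j i • (wElem q d i * wElem q d j) := by
  rw [wElem_mul_wElem_eq_smul_term hq j i, wElem_mul_wElem_eq_smul_term hq i j, smul_smul,
    multideg_append_comm, gMatrix, div_mul_cancel₀ _ (phi_ne_zero hq i j)]

theorem wElem_mul_wElem_ne_zero (hq : IsMultAntisymm q) (i j : Fin (numN n d + 1)) :
    wElem q d i * wElem q d j ≠ 0 := by
  intro h
  have h' := normalForm_wElem_mul_wElem hq i j
  rw [h, map_zero] at h'
  exact phi_ne_zero hq i j (Finsupp.single_eq_zero.1 h'.symm)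

theorem exists_veroneseMap (hq : IsMultAntisymm q) :
    ∃ v : QuantumSpace (gMatrix q d) →ₐ[ℂ] QuantumSpace q,
      ∀ i, v (gen (gMatrix q d) i) = wElem q d i := by
  refine ⟨RingQuot.liftAlgHom ℂ ⟨FreeAlgebra.lift ℂ (wElem q d), ?_⟩, fun i => ?_⟩
  · rintro _ _ ⟨i, j, hij⟩
    simp only [map_mul, map_smul, FreeAlgebra.lift_ι_apply]
    exact wElem_mul_wElem_comm hq i j
  · unfold gen
    rw [RingQuot.liftAlgHom_mkAlgHom_apply, FreeAlgebra.lift_ι_apply]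

theorem eq_gMatrix_of_algHom (hq : IsMultAntisymm q)
    {g : Matrix (Fin (numN n d + 1)) (Fin (numN n d + 1)) ℂ} (hg : IsMultAntisymm g)
    (v : QuantumSpace g →ₐ[ℂ] QuantumSpace q) (hv : ∀ i, v (gen g i) = wElem q d i) :
    g = gMatrix q d := by
  have hG := isMultAntisymm_gMatrix (d := d) hq
  have key : ∀ i j, i < j → g j i = gMatrix q d j i := by
    intro i j hij
    have h := congrArg v (gen_mul_gen g hij)
    rw [map_smul, map_mul, map_mul, hv, hv, wElem_mul_wElem_comm hq i j] at h
    exact (smul_left_injective ℂ (wElem_mul_wElem_ne_zero hq i j) h).symm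
  ext j i
  rcases lt_trichotomy i j with h | rfl | h
  · exact key i j h
  · rw [hg.diag, hG.diag]
  · rw [hg.inv i j, hG.inv i j, key j i h]

section Hom

variable {g : Matrix (Fin (numN n d + 1)) (Fin (numN n d + 1)) ℂ}
  {v : QuantumSpace g →ₐ[ℂ] QuantumSpace q}

theorem map_wordElem (hv : ∀ i, v (gen g i) = wElem q d i) (u : List (Fin (numN n d + 1))) :
    v (wordElem g u) = wordElem q (expand n d u) := by
  induction u with
  | nil => simp [wordElem, expand]
  | cons i u ih =>
    have e : wordElem g (i :: u) = gen g i * wordElem g u := by simp [wordElem]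
    have e' : expand n d (i :: u) = wWord n d i ++ expand n d u := by simp [expand]
    rw [e, map_mul, hv, ih, e', wordElem_append, wElem]

/-! ### The image of the Veronese map -/

theorem mem_veroneseSubalgebra {f : QuantumSpace q} :
    f ∈ veroneseSubalgebra q d ↔ f ∈ ⨆ k : ℕ, gradedPiece q (k * d) := Iff.rfl

theorem range_le_veroneseSubalgebra (hv : ∀ i, v (gen g i) = wElem q d i) :
    v.range ≤ veroneseSubalgebra q d := by
  rintro _ ⟨f, rfl⟩
  change v f ∈ _
  rw [eq_linearCombination_term g f, Finsupp.sum, map_sum]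
  refine Subalgebra.sum_mem _ fun α _ => ?_
  rw [map_smul, term, map_wordElem hv]
  exact Subalgebra.smul_mem _ (mem_veroneseSubalgebra.2 (Submodule.mem_iSup_of_mem _
    (Submodule.subset_span ⟨_, length_expand _, rfl⟩))) _

/-- A word whose length is a multiple of `d` is a product of words of length `d`, each of which is
a scalar multiple of some `w_i`. -/
theorem wordElem_mem_range (hq : IsMultAntisymm q) (hv : ∀ i, v (gen g i) = wElem q d i)
    (k : ℕ) (w : List (Fin (n + 1))) (hw : w.length = k * d) : wordElem q w ∈ v.range := by
  induction k generalizing w with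
  | zero =>
    have : w = [] := List.eq_nil_of_length_eq_zero (by simpa using hw)
    rw [this]
    exact v.range.one_mem
  | succ k ih =>
    rw [Nat.add_mul, one_mul] at hw
    rw [← List.take_append_drop d w, wordElem_append]
    refine mul_mem ?_ (ih _ (by simp [hw]))
    obtain ⟨c, -, e⟩ := exists_wordElem_eq_smul_term hq (w.take d)
    have hlen : (orderedWord (multideg (w.take d))).length = d := by
      rw [(multideg_eq_iff_perm.1 (multideg_orderedWord _)).length_eq]
      simp [hw]
    obtain ⟨i, hi⟩ := exists_wWord_eq (isOrdered_orderedWord _) hlen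
    rw [e, term, ← hi]
    have hi' : wElem q d i ∈ v.range := ⟨gen g i, hv i⟩
    exact Subalgebra.smul_mem _ hi' c

theorem range_eq_veroneseSubalgebra (hq : IsMultAntisymm q)
    (hv : ∀ i, v (gen g i) = wElem q d i) : v.range = veroneseSubalgebra q d := by
  refine le_antisymm (range_le_veroneseSubalgebra hv) fun f hf => ?_
  have hle : (⨆ k : ℕ, gradedPiece q (k * d)) ≤ Subalgebra.toSubmodule v.range := by
    refine iSup_le fun k => Submodule.span_le.2 ?_
    rintro _ ⟨w, hw, rfl⟩
    exact wordElem_mem_range hq hv k w hw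
  exact hle (mem_veroneseSubalgebra.1 hf)

/-! ### The leading monomials of the kernel -/

/-- An element of the kernel cannot have a leading monomial whose image is an ordered word: the
images of its other monomials, being smaller, have different multi-degrees, so that nothing
cancels the image of the leading monomial. -/
theorem not_isOrdered_expand_of_isLM (hd : 1 ≤ d) (hq : IsMultAntisymm q)
    (hv : ∀ i, v (gen g i) = wElem q d i) {h : QuantumSpace g} (hker : v h = 0)
    {α : Fin (numN n d + 1) → ℕ} (hα : IsLM g h α) :
    ¬ IsOrdered (expand n d (orderedWord α)) := by
  intro ho
  set γ := multideg (expand n d (orderedWord α)) with hγ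
  have hsum : normalForm q (v h) γ = normalForm g h α := by
    conv_lhs => rw [eq_linearCombination_term g h, Finsupp.sum, map_sum, map_sum]
    rw [Finsupp.finsetSum_apply, Finset.sum_eq_single α]
    · rw [map_smul, term, map_wordElem hv, map_smul, normalForm_wordElem_of_isOrdered q ho]
      simp [hγ]
    · intro β hβ hβα
      have hne : multideg (expand n d (orderedWord β)) ≠ γ := fun e =>
        not_wordLT_of_isOrdered_expand hd ho e (hα.2 β hβ hβα)
      obtain ⟨c, -, e⟩ := exists_wordElem_eq_smul_term hq (expand n d (orderedWord β))
      rw [map_smul, term, map_wordElem hv, e, map_smul, map_smul, normalForm_term]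
      simp [hne]
    · exact fun hn => absurd hα.1 hn
  rw [hker, map_zero, Finsupp.zero_apply] at hsum
  exact Finsupp.mem_support_iff.1 hα.1 hsum.symm

end Hom

/-! ### The quadratic binomials -/

theorem gen_mul_gen_eq_wordElem {m : ℕ} (g : Matrix (Fin m) (Fin m) ℂ) (i j : Fin m) :
    gen g i * gen g j = wordElem g [i, j] := by
  simp [wordElem]

theorem pair_eq_of_multideg_eq {m : ℕ} {a b k l : Fin m} (hab : a ≤ b) (hkl : k ≤ l)
    (h : multideg [a, b] = multideg [k, l]) : a = k ∧ b = l := by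
  have := eq_of_isOrdered_of_multideg_eq (u := [a, b]) (v := [k, l]) (by simpa [IsOrdered])
    (by simpa [IsOrdered]) h
  simpa using this

theorem pair_eq_of_multideg_eq_add {m : ℕ} {a b k l : Fin m} {u : Fin m → ℕ} (hab : a ≤ b)
    (hkl : k ≤ l) (h : multideg [a, b] = u + multideg [k, l]) : a = k ∧ b = l := by
  refine pair_eq_of_multideg_eq hab hkl ?_
  rw [← multideg_orderedWord u, ← multideg_append] at h
  have hl := (multideg_eq_iff_perm.1 h).length_eq
  have hnil : orderedWord u = [] := List.eq_nil_of_length_eq_zero (by simpa using hl)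
  rwa [hnil, List.nil_append] at h

/-- The condition `Nor(w_i w_j) = φ_{ij} w_{i'} w_{j'}` is an equality of multi-degrees. -/
theorem mem_veroneseBinomials (hq : IsMultAntisymm q) {f : QuantumSpace (gMatrix q d)} :
    f ∈ veroneseBinomials q d ↔ ∃ i j i' j', (i, j) ∈ setMV n d ∧ (i', j') ∈ setC n d ∧
      multideg (wWord n d i' ++ wWord n d j') = multideg (wWord n d i ++ wWord n d j) ∧
      f = gen (gMatrix q d) i * gen (gMatrix q d) j
        - phi q d i j • (gen (gMatrix q d) i' * gen (gMatrix q d) j') := by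
  have h : ∀ i j i' j', normalForm q (wElem q d i * wElem q d j)
      = Finsupp.single (multideg (wWord n d i' ++ wWord n d j')) (phi q d i j) ↔
      multideg (wWord n d i' ++ wWord n d j') = multideg (wWord n d i ++ wWord n d j) := by
    intro i j i' j'
    rw [normalForm_wElem_mul_wElem hq, Finsupp.single_left_inj (phi_ne_zero hq i j), eq_comm]
  simp only [veroneseBinomials, Set.mem_ofPred_eq, h]

theorem normalForm_binomial {m : ℕ} (g : Matrix (Fin m) (Fin m) ℂ) {i j i' j' : Fin m}
    (h : i ≤ j) (h' : i' ≤ j') (c : ℂ) :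
    normalForm g (gen g i * gen g j - c • (gen g i' * gen g j'))
      = Finsupp.single (multideg [i, j]) 1 - Finsupp.single (multideg [i', j']) c := by
  rw [gen_mul_gen_eq_wordElem, gen_mul_gen_eq_wordElem, map_sub, map_smul,
    normalForm_wordElem_of_isOrdered g (by simpa [IsOrdered]),
    normalForm_wordElem_of_isOrdered g (by simpa [IsOrdered]), Finsupp.smul_single, smul_eq_mul,
    mul_one]

theorem mem_support_binomial {m : ℕ} (g : Matrix (Fin m) (Fin m) ℂ) {i j i' j' : Fin m}
    (h : i ≤ j) (h' : i' ≤ j') {c : ℂ} {α : Fin m → ℕ}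
    (hα : α ∈ (normalForm g (gen g i * gen g j - c • (gen g i' * gen g j'))).support) :
    α = multideg [i, j] ∨ α = multideg [i', j'] := by
  rw [normalForm_binomial g h h'] at hα
  by_contra hne
  rw [not_or] at hne
  rw [Finsupp.mem_support_iff] at hα
  exact hα (by simp [Ne.symm hne.1, Ne.symm hne.2])

theorem isLM_binomial {m : ℕ} (g : Matrix (Fin m) (Fin m) ℂ) {i j i' j' : Fin m}
    (h : i ≤ j) (h' : i' ≤ j') (hlt : WordLT [i', j'] [i, j]) (c : ℂ) :
    IsLM g (gen g i * gen g j - c • (gen g i' * gen g j')) (multideg [i, j]) ∧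
      normalForm g (gen g i * gen g j - c • (gen g i' * gen g j')) (multideg [i, j]) = 1 := by
  have hT : TermLT (multideg [i', j']) (multideg [i, j]) :=
    (termLT_multideg (by simpa [IsOrdered]) (by simpa [IsOrdered])).2 hlt
  have hne : multideg [i', j'] ≠ multideg [i, j] := fun e => (e ▸ hT).asymm (e ▸ hT)
  have h1 : normalForm g (gen g i * gen g j - c • (gen g i' * gen g j')) (multideg [i, j])
      = 1 := by
    rw [normalForm_binomial g h h']
    simp [hne]
  refine ⟨⟨by rw [Finsupp.mem_support_iff, h1]; exact one_ne_zero, fun β hβ hβne => ?_⟩, h1⟩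
  rcases mem_support_binomial g h h' hβ with rfl | rfl
  · exact absurd rfl hβne
  · exact hT

/-- The leading monomial of a Veronese binomial is the monomial of its pair in `MV(n,d)`. -/
theorem isLM_veroneseBinomial (hd : 1 ≤ d) {i j i' j' : Fin (numN n d + 1)}
    (h : (i, j) ∈ setMV n d) (h' : (i', j') ∈ setC n d)
    (hdeg : multideg (wWord n d i' ++ wWord n d j') = multideg (wWord n d i ++ wWord n d j)) :
    IsLM (gMatrix q d) (gen (gMatrix q d) i * gen (gMatrix q d) j
      - phi q d i j • (gen (gMatrix q d) i' * gen (gMatrix q d) j')) (multideg [i, j]) :=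
  (isLM_binomial _ h.1 h'.1 (wordLT_of_setC_of_setMV hd h h' hdeg) _).1

theorem exists_setMV_isLM (hd : 1 ≤ d) (hq : IsMultAntisymm q)
    {f : QuantumSpace (gMatrix q d)} (hf : f ∈ veroneseBinomials q d) :
    ∃ p ∈ setMV n d, IsLM (gMatrix q d) f (multideg [p.1, p.2]) := by
  obtain ⟨i, j, i', j', h, h', hdeg, rfl⟩ := (mem_veroneseBinomials hq).1 hf
  exact ⟨(i, j), h, isLM_veroneseBinomial hd h h' hdeg⟩

theorem exists_veroneseBinomial_isLM (hd : 1 ≤ d) (hq : IsMultAntisymm q)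
    {p : Fin (numN n d + 1) × Fin (numN n d + 1)} (h : p ∈ setMV n d) :
    ∃ f ∈ veroneseBinomials q d, IsLM (gMatrix q d) f (multideg [p.1, p.2]) := by
  obtain ⟨⟨i', j'⟩, ⟨hC, hdeg⟩, -⟩ := existsUnique_setC hd
    (w := wWord n d p.1 ++ wWord n d p.2) (by simp [length_wWord])
  exact ⟨_, (mem_veroneseBinomials hq).2 ⟨p.1, p.2, i', j', h, hC, hdeg, rfl⟩,
    isLM_veroneseBinomial hd h hC hdeg⟩

/-- A Veronese binomial is determined by its leading monomial. -/
theorem veroneseBinomial_eq_of_isLM (hd : 1 ≤ d) (hq : IsMultAntisymm q)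
    {f f' : QuantumSpace (gMatrix q d)} (hf : f ∈ veroneseBinomials q d)
    (hf' : f' ∈ veroneseBinomials q d) {α : Fin (numN n d + 1) → ℕ}
    (hα : IsLM (gMatrix q d) f α) (hα' : IsLM (gMatrix q d) f' α) : f = f' := by
  obtain ⟨i, j, a, b, h, hab, hdeg, rfl⟩ := (mem_veroneseBinomials hq).1 hf
  obtain ⟨i', j', a', b', h', hab', hdeg', rfl⟩ := (mem_veroneseBinomials hq).1 hf'
  obtain ⟨rfl, rfl⟩ := pair_eq_of_multideg_eq h.1 h'.1
    (((isLM_veroneseBinomial hd h hab hdeg).unique hα).trans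
      (hα'.unique (isLM_veroneseBinomial hd h' hab' hdeg')))
  have hp := (existsUnique_setC hd (w := wWord n d i ++ wWord n d j)
    (by simp [length_wWord])).unique (y₁ := (a, b)) (y₂ := (a', b')) ⟨hab, hdeg⟩ ⟨hab', hdeg'⟩
  obtain ⟨rfl, rfl⟩ := Prod.ext_iff.1 hp
  rfl

/-- Passing to leading monomials identifies the Veronese binomials with the pairs in
`MV(n,d)`. -/
theorem finite_veroneseBinomials_and_ncard_eq (hd : 1 ≤ d) (hq : IsMultAntisymm q) :
    (veroneseBinomials q d).Finite ∧ (veroneseBinomials q d).ncard = (setMV n d).ncard := by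
  choose! F hF hLM using fun p (hp : p ∈ setMV n d) => exists_veroneseBinomial_isLM hd hq hp
  have hbij : Set.BijOn F (setMV n d) (veroneseBinomials q d) := by
    refine ⟨hF, fun p hp p' hp' e => ?_, fun f hf => ?_⟩
    · have h := (hLM p hp).unique (e ▸ hLM p' hp')
      obtain ⟨h1, h2⟩ := pair_eq_of_multideg_eq hp.1 hp'.1 h
      exact Prod.ext h1 h2
    · obtain ⟨p, hp, hfp⟩ := exists_setMV_isLM hd hq hf
      exact ⟨p, hp, veroneseBinomial_eq_of_isLM hd hq (hF p hp) hf (hLM p hp) hfp⟩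
  exact ⟨hbij.finite_iff_finite.1 (Set.toFinite _), hbij.ncard_eq.symm⟩

/-! ### The kernel of the Veronese map -/

variable {v : QuantumSpace (gMatrix q d) →ₐ[ℂ] QuantumSpace q}

theorem map_veroneseBinomial (hq : IsMultAntisymm q)
    (hv : ∀ i, v (gen (gMatrix q d) i) = wElem q d i) {f : QuantumSpace (gMatrix q d)}
    (hf : f ∈ veroneseBinomials q d) : v f = 0 := by
  obtain ⟨i, j, i', j', -, h', hdeg, rfl⟩ := (mem_veroneseBinomials hq).1 hf
  rw [map_sub, map_smul, map_mul, map_mul, hv, hv, hv, hv, wElem_mul_wElem_eq_smul_term hq i j,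
    wElem_mul_wElem i' j', wordElem_eq_term q h'.2, hdeg, sub_self]

/-- A monomial whose expansion is not ordered is divisible by the leading monomial of a Veronese
binomial: some pair of its letters lies in `MV(n,d)`. -/
theorem exists_veroneseBinomial_dvd (hd : 1 ≤ d) (hq : IsMultAntisymm q)
    {α : Fin (numN n d + 1) → ℕ} (hα : ¬ IsOrdered (expand n d (orderedWord α))) :
    ∃ f ∈ veroneseBinomials q d, ∃ β u, IsLM (gMatrix q d) f β ∧ α = u + β := by
  by_contra hno
  refine hα (isOrdered_expand (List.pairwise_iff_forall_sublist.2 fun {i j} hij => ?_))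
  by_contra hord
  have hle : i ≤ j := isOrdered_pair.1 ((isOrdered_orderedWord α).sublist hij)
  obtain ⟨f, hf, hLM⟩ := exists_veroneseBinomial_isLM hd hq (p := (i, j)) ⟨hle, hord⟩
  refine hno ⟨f, hf, _, α - multideg [i, j], hLM, (tsub_add_cancel_of_le fun k => ?_).symm⟩
  calc multideg [i, j] k ≤ multideg (orderedWord α) k := hij.count_le k
    _ = α k := by rw [multideg_orderedWord]

theorem isGroebnerBasis_veroneseBinomials (hd : 1 ≤ d) (hq : IsMultAntisymm q)
    (hv : ∀ i, v (gen (gMatrix q d) i) = wElem q d i) :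
    IsGroebnerBasis (gMatrix q d) (TwoSidedIdeal.ker v) (veroneseBinomials q d) := by
  refine ⟨fun f hf => (TwoSidedIdeal.mem_ker _).2 (map_veroneseBinomial hq hv hf),
    fun h hker h0 => ?_⟩
  obtain ⟨α, hα⟩ := exists_isLM h0
  obtain ⟨f, hf, β, u, hβ, e⟩ := exists_veroneseBinomial_dvd hd hq
    (not_isOrdered_expand_of_isLM hd hq hv ((TwoSidedIdeal.mem_ker _).1 hker) hα)
  exact ⟨f, hf, α, β, u, hα, hβ, e⟩

/-- No monomial of a Veronese binomial is divisible by the leading monomial of another one. -/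
theorem isNormalMod_veroneseBinomials (hd : 1 ≤ d) (hq : IsMultAntisymm q)
    {f : QuantumSpace (gMatrix q d)} (hf : f ∈ veroneseBinomials q d)
    {α : Fin (numN n d + 1) → ℕ} (hα : α ∈ (normalForm (gMatrix q d) f).support) :
    IsNormalMod (gMatrix q d) (veroneseBinomials q d \ {f}) α := by
  rintro f' ⟨hf', hne⟩ β hβ ⟨u, e⟩
  obtain ⟨⟨k, l⟩, hkl, hLM⟩ := exists_setMV_isLM hd hq hf'
  obtain rfl := hβ.unique hLM
  obtain ⟨i, j, i', j', h, h', hdeg, rfl⟩ := (mem_veroneseBinomials hq).1 hf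
  rcases mem_support_binomial _ h.1 h'.1 hα with rfl | rfl
  · obtain ⟨rfl, rfl⟩ := pair_eq_of_multideg_eq_add h.1 hkl.1 e
    exact hne (veroneseBinomial_eq_of_isLM hd hq hf' hf hβ
      (isLM_veroneseBinomial hd h h' hdeg))
  · obtain ⟨rfl, rfl⟩ := pair_eq_of_multideg_eq_add h'.1 hkl.1 e
    exact hkl.2 h'.2

theorem isReducedGroebnerBasis_veroneseBinomials (hd : 1 ≤ d) (hq : IsMultAntisymm q)
    (hv : ∀ i, v (gen (gMatrix q d) i) = wElem q d i) :
    IsReducedGroebnerBasis (gMatrix q d) (TwoSidedIdeal.ker v) (veroneseBinomials q d) where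
  groebner := isGroebnerBasis_veroneseBinomials hd hq hv
  monic f hf := by
    obtain ⟨i, j, i', j', h, h', hdeg, rfl⟩ := (mem_veroneseBinomials hq).1 hf
    exact ⟨_, isLM_binomial _ h.1 h'.1 (wordLT_of_setC_of_setMV hd h h' hdeg) _⟩
  minimal f hf hG := by
    obtain ⟨p, -, hp⟩ := exists_setMV_isLM hd hq hf
    have h0 : f ≠ 0 := by
      rintro rfl
      simpa using hp.1
    obtain ⟨f', hf', α, β, u, hα, hβ, e⟩ :=
      hG.2 f ((TwoSidedIdeal.mem_ker _).2 (map_veroneseBinomial hq hv hf)) h0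
    exact isNormalMod_veroneseBinomials hd hq hf hα.1 f' hf' β hβ ⟨u, e⟩
  reduced _ hf _ hα := isNormalMod_veroneseBinomials hd hq hf hα

theorem existsUnique_setC_normalForm_map (hd : 1 ≤ d) (hq : IsMultAntisymm q)
    (hv : ∀ i, v (gen (gMatrix q d) i) = wElem q d i) {i j : Fin (numN n d + 1)}
    (h : (i, j) ∈ setMV n d) :
    ∃! p : Fin (numN n d + 1) × Fin (numN n d + 1), p ∈ setC n d ∧
      normalForm q (v (gen (gMatrix q d) i * gen (gMatrix q d) j))
        = phi q d i j • normalForm q (v (gen (gMatrix q d) p.1 * gen (gMatrix q d) p.2)) ∧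
      WordLT [p.1, p.2] [i, j] := by
  have key : ∀ p ∈ setC n d, (normalForm q (v (gen (gMatrix q d) i * gen (gMatrix q d) j))
      = phi q d i j • normalForm q (v (gen (gMatrix q d) p.1 * gen (gMatrix q d) p.2)) ↔
      multideg (wWord n d p.1 ++ wWord n d p.2) = multideg (wWord n d i ++ wWord n d j)) := by
    intro p hp
    rw [map_mul v, map_mul v, hv, hv, hv, hv, normalForm_wElem_mul_wElem hq i j,
      wElem_mul_wElem p.1 p.2, normalForm_wordElem_of_isOrdered q hp.2, Finsupp.smul_single,
      smul_eq_mul, mul_one, Finsupp.single_left_inj (phi_ne_zero hq i j), eq_comm]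
  obtain ⟨p, ⟨hp, hdeg⟩, huniq⟩ := existsUnique_setC hd
    (w := wWord n d i ++ wWord n d j) (by simp [length_wWord])
  exact ⟨p, ⟨hp, (key p hp).2 hdeg, wordLT_of_setC_of_setMV hd h hp hdeg⟩,
    fun p' hp' => huniq p' ⟨hp'.1, (key p' hp'.1).1 hp'.2.1⟩⟩

end VeroneseMap

end NCVeronese

theorem mainTheorem1 (n d : ℕ) (hn : 1 ≤ n) (hd : 1 ≤ d)
    (q : Matrix (Fin (n + 1)) (Fin (n + 1)) ℂ) (hq : IsMultAntisymm q) :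
    -- the matrix `g` is the only multiplicatively anti-symmetric matrix for which the assignment
    -- `y_i ↦ w_i` extends to an algebra homomorphism
    IsMultAntisymm (gMatrix q d) ∧
    (∃ v : QuantumSpace (gMatrix q d) →ₐ[ℂ] QuantumSpace q,
      ∀ i, v (gen (gMatrix q d) i) = wElem q d i) ∧
    (∀ g : Matrix (Fin (numN n d + 1)) (Fin (numN n d + 1)) ℂ, IsMultAntisymm g →
      (∃ v : QuantumSpace g →ₐ[ℂ] QuantumSpace q, ∀ i, v (gen g i) = wElem q d i) →
      g = gMatrix q d) ∧
    -- the Veronese map `v`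
    ∀ v : QuantumSpace (gMatrix q d) →ₐ[ℂ] QuantumSpace q,
      (∀ i, v (gen (gMatrix q d) i) = wElem q d i) →
      -- its image
      v.range = veroneseSubalgebra q d ∧
      -- its kernel
      IsReducedGroebnerBasis (gMatrix q d) (TwoSidedIdeal.ker v) (veroneseBinomials q d) ∧
      (veroneseBinomials q d).Finite ∧
      (veroneseBinomials q d).ncard + (n + 2 * d).choose n = (numN n d + 2).choose 2 ∧
      -- every pair in `MV(n,d)` gives exactly one of the binomials
      ∀ i j, (i, j) ∈ setMV n d → phi q d i j ≠ 0 ∧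
        ∃! p : Fin (numN n d + 1) × Fin (numN n d + 1), p ∈ setC n d ∧
          normalForm q (v (gen (gMatrix q d) i * gen (gMatrix q d) j))
            = phi q d i j •
              normalForm q (v (gen (gMatrix q d) p.1 * gen (gMatrix q d) p.2)) ∧
          WordLT [p.1, p.2] [i, j] := by
  refine ⟨isMultAntisymm_gMatrix hq, exists_veroneseMap hq,
    fun g hg ⟨v, hv⟩ => eq_gMatrix_of_algHom hq hg v hv, fun v hv => ?_⟩
  obtain ⟨hfin, hcard⟩ := finite_veroneseBinomials_and_ncard_eq (d := d) hd hq
  refine ⟨range_eq_veroneseSubalgebra hq hv, isReducedGroebnerBasis_veroneseBinomials hd hq hv,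
    hfin, ?_, fun i j h => ⟨phi_ne_zero hq i j, existsUnique_setC_normalForm_map hd hq hv h⟩⟩
  rw [hcard, ← ncard_setC hd, ncard_setMV_add_ncard_setC]
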